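/- **Session types.** Fix a set $L$ of labels and a set of recursion variables. Session types are the terms $T ::= \oplus\{l_i:T_i\}_{i\in I} \mid \&\{l_i:T_i\}_{i\in I} \mid \mu t.T \mid t \mid \mathbf{end}$ ($I$ finite and non-empty, the labels $l_i\in L$ of one choice pairwise distinct) that are closed and in which every recursion is guarded (in $\mu t.T$ each free occurrence of $t$ in $T$ lies under some $\oplus$ or $\&$). The unfolding $\mathsf{unf}^1$ maps $\mu t.T$ to $T\{\mu t.T/t\}$, fixes $\mathbf{end}$ and acts on $\oplus$ and $\&$ componentwise; $\mathsf{unf}^0(T)=T$, $\mathsf{unf}^{n}(T)=\mathsf{unf}^1(\mathsf{unf}^{n-1}(T))$. An input context is a term $\mathcal A ::= [\,]^k \mid \&\{l_i:\mathcal A_i\}_{i\in I}$ whose holes are numbered $1,\dots,m$ for some $m\ge 1$, each number occurring exactly once; $\mathcal A[T_h]_{h\le m}$ is the result of filling its holes; $\mathcal A$ is $k$-bounded if at most $k$ inputs are nested in it. **Bounded asynchronous subtyping.** For $k\ge 0$, a relation $\mathcal R$ on types is a *$k$-bounded asynchronous subtyping relation* if $(T,S)\in\mathcal R$ implies: 1.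 if $T=\mathbf{end}$, then $\mathsf{unf}^n(S)=\mathbf{end}$ for some $n\ge 0$; 2. if $T=\oplus\{l_i:T_i\}_{i\in I}$, then there are $n\ge 0$ and a $k$-bounded input context $\mathcal A$ with $\mathsf{unf}^n(S)=\mathcal A[\oplus\{l_j:S_{hj}\}_{j\in J_h}]_{h\le m}$, $I\subseteq J_h$ for all $h$, $(T_i,\mathcal A[S_{hi}]_{h\le m})\in\mathcal R$ for all $i\in I$, and, if $\mathcal A\ne[\,]^1$, every $T_i$ contains an input branching; 3. if $T=\&\{l_i:T_i\}_{i\in I}$, then there is $n\ge 0$ with $\mathsf{unf}^n(S)=\&\{l_j:S_j\}_{j\in J}$, $J\subseteq I$ and $(T_j,S_j)\in\mathcal R$ for all $j\in J$; 4. if $T=\mu t.T'$, then $(T'\{T/t\},S)\in\mathcal R$. Write $T\le_k S$ if some such $\mathcal R$ contains $(T,S)$, and $T\le_{\mathsf{bound}}S$ if $T\le_k S$ for some $k$. **Queue machines.** A queue machine is $M=(Q,\Sigma,\Gamma,\$,s,\delta)$ with $Q$, $\Gamma$ finite, $\Sigma\subset\Gamma$, $\$\in\Gamma\setminus\Sigma$,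 $s\in Q$ and $\delta:Q\times\Gamma\to Q\times\Gamma^*$. Configurations are pairs $(q,\gamma)\in Q\times\Gamma^*$, and $(p,A\alpha)\to_M(q,\alpha\gamma)$ when $\delta(p,A)=(q,\gamma)$. On input $x\in\Sigma^*$ the machine starts in $(s,x\$)$. It *terminates* on $x$ if $(s,x\$)\to_M^*(q,\varepsilon)$ for some $q$, and it is *bound* on $x$ if there is $k$ such that $|\gamma|\le k$ whenever $(s,x\$)\to_M^*(q,\gamma)$. **Encoding.** Take the symbols in $\Gamma$ as labels and the states in $Q$ as (distinct) recursion variables. For $\mathcal S\subseteq Q$ let $[\![q]\!]^{\mathcal S}$ be the variable $q$ if $q\in\mathcal S$, and otherwise $$[\![q]\!]^{\mathcal S}=\mu q.\&\bigl\{A:\oplus\{B^A_1:\cdots\oplus\{B^A_{n_A}:[\![q']\!]^{\mathcal S\cup\{q\}}\}\cdots\}\bigr\}_{A\in\Gamma},\qquad \delta(q,A)=(q',B^A_1\cdots B^A_{n_A})$$ (where $q'$ depends on $A$). For $C_1,\dots,C_m\in\Gamma$ let $$[\![C_1\cdots C_m]\!]=\&\bigl\{C_1:\cdots\&\{C_m:\mu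 t.\oplus\{A:\&\{A:t\}\}_{A\in\Gamma}\}\cdots\bigr\}.$$ **Theorem.** For every queue machine $M=(Q,\Sigma,\Gamma,\$,s,\delta)$ and every input string $x\in\Sigma^*$, $$[\![s]\!]^{\emptyset}\le_{\mathsf{bound}}[\![x\$]\!]\iff M\text{ does not terminate on }x\text{ and is bound on }x.$$ **Corollary.** Bounded asynchronous subtyping is undecidable: with $L=\mathbb N$ and recursion variables in $\mathbb N$, no algorithm decides, given (codes of) two session types $T$, $S$, whether $T\le_{\mathsf{bound}}S$. -/

import Mathlib

universe u v

/-- Raw syntax of binary session types over labels `L` and recursion variables `V`.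
`sel I T` is the output selection `⊕{l : T l}_{l ∈ I}`, `bra I T` is the input branching
`&{l : T l}_{l ∈ I}`; the finite index set is the set of (pairwise distinct) labels itself. -/
inductive SType (L : Type u) (V : Type v) : Type (max u v)
  | sel (I : Finset L) (T : ↥I → SType L V) : SType L V
  | bra (I : Finset L) (T : ↥I → SType L V) : SType L V
  | mu (t : V) (T : SType L V) : SType L V
  | var (t : V) : SType L V
  | endT : SType L V

namespace SType

/-- All variables that occur free belong to `X`. -/
def ClosedIn {L : Type u} {V : Type v} : Set V → SType L V → Prop
  | X, sel _ T => ∀ i, ClosedIn X (T i)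
  | X, bra _ T => ∀ i, ClosedIn X (T i)
  | X, mu t T => ClosedIn (insert t X) T
  | X, var t => t ∈ X
  | _, endT => True

/-- `t` has a free occurrence that is not in the scope of any output or input. -/
def UnguardedIn {L : Type u} {V : Type v} (t : V) : SType L V → Prop
  | sel _ _ => False
  | bra _ _ => False
  | mu u T => u ≠ t ∧ UnguardedIn t T
  | var u => u = t
  | endT => False

/-- Every recursion is guarded. -/
def Guarded {L : Type u} {V : Type v} : SType L V → Prop
  | sel _ T => ∀ i, Guarded (T i)
  | bra _ T => ∀ i, Guarded (T i)
  | mu t T => ¬ UnguardedIn t T ∧ Guarded T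
  | var _ => True
  | endT => True

/-- Every selection and every branching offers at least one label. -/
def NonemptyChoices {L : Type u} {V : Type v} : SType L V → Prop
  | sel I T => I.Nonempty ∧ ∀ i, NonemptyChoices (T i)
  | bra I T => I.Nonempty ∧ ∀ i, NonemptyChoices (T i)
  | mu _ T => NonemptyChoices T
  | var _ => True
  | endT => True

/-- The session types proper: closed, guarded, with non-empty choices. -/
def IsSessionType {L : Type u} {V : Type v} (T : SType L V) : Prop :=
  T.ClosedIn ∅ ∧ T.Guarded ∧ T.NonemptyChoices

/-- `T.subst t N` is `T{N/t}`, for closed `N` (so that no capture can occur). -/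
def subst {L : Type u} {V : Type v} [DecidableEq V] (t : V) (N : SType L V) :
    SType L V → SType L V
  | sel I T => sel I fun i => subst t N (T i)
  | bra I T => bra I fun i => subst t N (T i)
  | mu u T => if u = t then mu u T else mu u (subst t N T)
  | var u => if u = t then N else var u
  | endT => endT

/-- One unfolding; closed types never expose a variable. -/
def unfoldOnce {L : Type u} {V : Type v} [DecidableEq V] : SType L V → SType L V
  | sel I T => sel I fun i => unfoldOnce (T i)
  | bra I T => bra I fun i => unfoldOnce (T i)
  | mu t T => subst t (mu t T) T
  | var t => var t
  | endT => endT

/-- `n`-unfolding. -/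
def unfold {L : Type u} {V : Type v} [DecidableEq V] : ℕ → SType L V → SType L V
  | 0, T => T
  | n + 1, T => unfoldOnce (unfold n T)

/-- `& ∈ T`: the type contains at least one input branching. -/
def HasInput {L : Type u} {V : Type v} : SType L V → Prop
  | sel _ T => ∃ i, HasInput (T i)
  | bra _ _ => True
  | mu _ T => HasInput T
  | var _ => False
  | endT => False

end SType

/-- Input contexts with holes numbered by `Fin m`. -/
inductive InputContext (L : Type u) (m : ℕ) : Type u
  | hole (k : Fin m) : InputContext L m
  | bra (I : Finset L) (A : ↥I → InputContext L m) : InputContext L m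

namespace InputContext

/-- Number of occurrences of the hole `k`. -/
def holeCount {L : Type u} {m : ℕ} (k : Fin m) : InputContext L m → ℕ
  | hole j => if j = k then 1 else 0
  | bra _ A => ∑ i, holeCount k (A i)

/-- There is at least one hole, and each of the `m` holes occurs exactly once. -/
def WellFormed {L : Type u} {m : ℕ} (A : InputContext L m) : Prop :=
  1 ≤ m ∧ ∀ k, A.holeCount k = 1

/-- Fill every hole `k` with `T k`. -/
def fill {L : Type u} {V : Type v} {m : ℕ} (T : Fin m → SType L V) :
    InputContext L m → SType L V
  | hole k => T k
  | bra I A => SType.bra I fun i => fill T (A i)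

/-- The maximal number of nested inputs. -/
def depth {L : Type u} {m : ℕ} : InputContext L m → ℕ
  | hole _ => 0
  | bra _ A => 1 + Finset.univ.sup fun i => depth (A i)

end InputContext

namespace SType

/-- `R` is a `k`-bounded asynchronous subtyping relation. -/
structure IsBoundedSubtypingRel {L : Type u} {V : Type v} [DecidableEq V] (k : ℕ)
    (R : SType L V → SType L V → Prop) : Prop where
  endT : ∀ S, R endT S → ∃ n, unfold n S = endT
  sel : ∀ (I : Finset L) (T : ↥I → SType L V) (S : SType L V), R (sel I T) S →
    ∃ (n m : ℕ) (A : InputContext L m) (J : Fin m → Finset L)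
      (S' : ∀ h, ↥(J h) → SType L V) (hJ : ∀ h, I ⊆ J h),
      A.WellFormed ∧ A.depth ≤ k ∧
      unfold n S = A.fill (fun h => SType.sel (J h) (S' h)) ∧
      (∀ i : ↥I, R (T i) (A.fill fun h => S' h ⟨i.1, hJ h i.2⟩)) ∧
      ((∀ h, A ≠ InputContext.hole h) → ∀ i, HasInput (T i))
  bra : ∀ (I : Finset L) (T : ↥I → SType L V) (S : SType L V), R (bra I T) S →
    ∃ (n : ℕ) (J : Finset L) (S' : ↥J → SType L V) (hJ : J ⊆ I),
      unfold n S = SType.bra J S' ∧ ∀ j : ↥J, R (T ⟨j.1, hJ j.2⟩) (S' j)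
  mu : ∀ (t : V) (T S : SType L V), R (mu t T) S → R (subst t (SType.mu t T) T) S

/-- `k`-bounded asynchronous subtyping `T ≤_k S`. -/
def KBoundedSubtype {L : Type u} {V : Type v} [DecidableEq V] (k : ℕ) (T S : SType L V) : Prop :=
  ∃ R : SType L V → SType L V → Prop, IsBoundedSubtypingRel k R ∧ R T S

/-- Bounded asynchronous subtyping `T ≤_bound S`. -/
def BoundedSubtype {L : Type u} {V : Type v} [DecidableEq V] (T S : SType L V) : Prop :=
  ∃ k, KBoundedSubtype k T S

/-- Single-choice outputs `⊕{B₁ : ⋯ ⊕{Bₙ : T}}`. -/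
def outputs {L : Type u} {V : Type v} : List L → SType L V → SType L V
  | [], T => T
  | B :: w, T => sel {B} fun _ => outputs w T

/-- Single-choice inputs `&{C₁ : ⋯ &{Cₙ : T}}`. -/
def inputs {L : Type u} {V : Type v} : List L → SType L V → SType L V
  | [], T => T
  | C :: w, T => bra {C} fun _ => inputs w T

/-- Gödel numbering of types whose labels and variables are natural numbers. A choice is coded by
the list of its (label, code of continuation) pairs, in increasing order of the labels. -/
def code : SType ℕ ℕ → ℕ
  | sel I T => Nat.pair 0 (Encodable.encode
      (((Finset.univ : Finset ↥I).sort (· ≤ ·)).map fun i => (i.1, code (T i))))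
  | bra I T => Nat.pair 1 (Encodable.encode
      (((Finset.univ : Finset ↥I).sort (· ≤ ·)).map fun i => (i.1, code (T i))))
  | mu t T => Nat.pair 2 (Nat.pair t (code T))
  | var t => Nat.pair 3 t
  | endT => Nat.pair 4 0

theorem eq_of_choiceList_eq {I J : Finset ℕ} {f : ↥I → ℕ} {g : ↥J → ℕ}
    (h : ((Finset.univ : Finset ↥I).sort (· ≤ ·)).map (fun i => (i.1, f i)) =
      ((Finset.univ : Finset ↥J).sort (· ≤ ·)).map (fun i => (i.1, g i))) :
    ∃ e : I = J, ∀ i : ↥I, f i = g ⟨i.1, e ▸ i.2⟩ := by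
  have key : ∀ (n c : ℕ), (∃ hn : n ∈ I, f ⟨n, hn⟩ = c) ↔ (∃ hn : n ∈ J, g ⟨n, hn⟩ = c) := by
    intro n c
    have h1 := congrArg (fun l => (n, c) ∈ l) h
    simpa using h1
  have e : I = J := by
    ext n
    constructor
    · intro hn
      exact ((key n _).1 ⟨hn, rfl⟩).1
    · intro hn
      exact ((key n _).2 ⟨hn, rfl⟩).1
  refine ⟨e, fun i => ?_⟩
  obtain ⟨_, h2⟩ := (key i.1 _).1 ⟨i.2, rfl⟩
  exact h2.symm

theorem code_injective : Function.Injective code := by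
  intro T
  induction T with
  | sel I T ih =>
    intro S h
    cases S with
    | sel J S =>
      simp only [code, Nat.pair_eq_pair, Encodable.encode_inj, true_and] at h
      obtain ⟨rfl, h2⟩ := eq_of_choiceList_eq h
      congr
      funext i
      exact ih i (h2 i)
    | _ => simp [code, Nat.pair_eq_pair] at h
  | bra I T ih =>
    intro S h
    cases S with
    | bra J S =>
      simp only [code, Nat.pair_eq_pair, Encodable.encode_inj, true_and] at h
      obtain ⟨rfl, h2⟩ := eq_of_choiceList_eq h
      congr
      funext i
      exact ih i (h2 i)
    | _ => simp [code, Nat.pair_eq_pair] at h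
  | mu t T ih =>
    intro S h
    cases S with
    | mu u S =>
      simp only [code, Nat.pair_eq_pair, true_and] at h
      rw [h.1, ih h.2]
    | _ => simp [code, Nat.pair_eq_pair] at h
  | var t =>
    intro S h
    cases S with
    | var u =>
      simp only [code, Nat.pair_eq_pair, true_and] at h
      rw [h]
    | _ => simp [code, Nat.pair_eq_pair] at h
  | endT =>
    intro S h
    cases S with
    | endT => rfl
    | _ => simp [code, Nat.pair_eq_pair] at h

/-- There is an algorithm that, given any two session types, halts and says whether they are in
the relation `≤_bound`. Nothing is asked of it on other inputs. -/
def BoundedSubtypingDecidable : Prop :=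
  ∃ f : ℕ × ℕ →. Bool, Partrec f ∧
    ∀ T S : SType ℕ ℕ, T.IsSessionType → S.IsSessionType →
      ∃ b ∈ f (T.code, S.code), (b = true ↔ BoundedSubtype T S)

end SType

/-- A queue machine whose states and queue symbols are taken from the ambient types `V` and `L`
(which will serve as the recursion variables and as the labels of session types). -/
structure QueueMachine (L : Type u) (V : Type v) where
  /-- the finite set of states -/
  states : Finset V
  /-- the input alphabet -/
  inputAlphabet : Finset L
  /-- the queue alphabet -/
  queueAlphabet : Finset L
  input_subset : inputAlphabet ⊆ queueAlphabet
  /-- the initial queue symbol -/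
  initSymbol : L
  initSymbol_mem : initSymbol ∈ queueAlphabet
  initSymbol_notMem : initSymbol ∉ inputAlphabet
  /-- the start state -/
  start : ↥states
  /-- the transition function -/
  trans : ↥states → ↥queueAlphabet → ↥states × List ↥queueAlphabet

namespace QueueMachine

/-- A state together with the content of the queue (head first). -/
abbrev Config {L : Type u} {V : Type v} (M : QueueMachine L V) : Type (max u v) :=
  ↥M.states × List ↥M.queueAlphabet

/-- One transition. -/
inductive Step {L : Type u} {V : Type v} (M : QueueMachine L V) : M.Config → M.Config → Prop
  | mk (p : ↥M.states) (A : ↥M.queueAlphabet) (α : List ↥M.queueAlphabet) :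
      Step M (p, A :: α) ((M.trans p A).1, α ++ (M.trans p A).2)

/-- The initial queue: the input string followed by the initial queue symbol. -/
def initQueue {L : Type u} {V : Type v} (M : QueueMachine L V) (x : List ↥M.inputAlphabet) :
    List ↥M.queueAlphabet :=
  x.map (fun a => ⟨a.1, M.input_subset a.2⟩) ++ [⟨M.initSymbol, M.initSymbol_mem⟩]

/-- `c` is reachable from the starting configuration on input `x`. -/
def Reaches {L : Type u} {V : Type v} (M : QueueMachine L V) (x : List ↥M.inputAlphabet)
    (c : M.Config) : Prop :=
  Relation.ReflTransGen M.Step (M.start, M.initQueue x) c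

/-- The machine terminates (accepts): it blocks by emptying the queue. -/
def TerminatesOn {L : Type u} {V : Type v} (M : QueueMachine L V)
    (x : List ↥M.inputAlphabet) : Prop :=
  ∃ q : ↥M.states, M.Reaches x (q, [])

/-- The machine is bound on input `x`: the queue length stays bounded. -/
def BoundOn {L : Type u} {V : Type v} (M : QueueMachine L V)
    (x : List ↥M.inputAlphabet) : Prop :=
  ∃ k : ℕ, ∀ (q : ↥M.states) (γ : List ↥M.queueAlphabet), M.Reaches x (q, γ) → γ.length ≤ k

/-- The finite control encoding of the state `q`, relative to the set `X` of states whose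
recursion variable is already bound. -/
def encodeControl {L : Type u} {V : Type v} [DecidableEq V] (M : QueueMachine L V)
    (X : Finset ↥M.states) (q : ↥M.states) : SType L V :=
  if q ∈ X then SType.var q.1
  else SType.mu q.1 (SType.bra M.queueAlphabet fun A =>
    SType.outputs ((M.trans q A).2.map Subtype.val)
      (encodeControl M (insert q X) (M.trans q A).1))
  termination_by Xᶜ.card
  decreasing_by
    apply Finset.card_lt_card
    rw [Finset.compl_ssubset_compl]
    exact Finset.ssubset_insert ‹_›

/-- The queue encoding of the content `w`, with recursion variable `t`. -/
def encodeQueue {L : Type u} {V : Type v} (M : QueueMachine L V) (t : V)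
    (w : List ↥M.queueAlphabet) : SType L V :=
  SType.inputs (w.map Subtype.val)
    (SType.mu t (SType.sel M.queueAlphabet fun A => SType.bra {A.1} fun _ => SType.var t))

end QueueMachine

/-! The control type of a state inputs one symbol and then outputs a word; the queue type inputs the
stored word and then acts as a buffer `μt.⊕{A : &{A : t}}`. Playing the subtyping rules on this pair
runs the machine. An input on the left must match the first stored symbol, which removes the queue
head. An output on the left must find a selection on the right below an input context; the only
selections lie behind the whole stored word, so the context is that word and its depth is the queue
length, while the buffer appends the output to the queue.

Hence a `k`-bounded relation follows every run and bounds its queue (`exists_isControl_of_reaches`),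
and it excludes the empty queue, since a buffer never offers an input
(`ne_nil_of_isBoundedSubtypingRel`). Conversely, if all reachable queues are non-empty and of length
at most `k`, the pairs met along the run form a `k`-bounded relation
(`isBoundedSubtypingRel_simRel`).

For undecidability, halting is reduced to "does not terminate and is bound". A partial recursive
program becomes a multi-stack machine, whose stacks are kept interleaved in one queue behind an end
marker. Each instruction is one sweep that adds a dummy symbol, and a halted machine rotates its
queue forever. The marker keeps the queue non-empty, and the dummies make it unbounded exactly if
the program diverges (`exists_sweep`, `loopsFrom_tm2System_iff`). For a program with undecidable
domain a single queue machine arises, and the code of the queue type is computable from the input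
(`exists_machine_forall_loops_iff`). -/

namespace SType

/-! ### Session types: closedness, substitution, unfoldings of the buffer -/

variable {L : Type u} {V : Type v}

theorem ClosedIn.mono {T : SType L V} {X Y : Set V} (h : T.ClosedIn X) (hXY : X ⊆ Y) :
    T.ClosedIn Y := by
  induction T generalizing X Y with
  | sel I T ih => exact fun i => ih i (h i) hXY
  | bra I T ih => exact fun i => ih i (h i) hXY
  | mu t T ih => exact ih h (Set.insert_subset_insert hXY)
  | var t => exact hXY h
  | endT => trivial

theorem ClosedIn.outputs {X : Set V} {T : SType L V} (h : T.ClosedIn X) :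
    ∀ w : List L, (outputs w T).ClosedIn X
  | [] => h
  | _ :: w => fun _ => h.outputs w

theorem ClosedIn.inputs {X : Set V} {T : SType L V} (h : T.ClosedIn X) :
    ∀ w : List L, (inputs w T).ClosedIn X
  | [] => h
  | _ :: w => fun _ => h.inputs w

theorem Guarded.outputs {T : SType L V} (h : T.Guarded) :
    ∀ w : List L, (SType.outputs w T).Guarded
  | [] => h
  | _ :: w => fun _ => Guarded.outputs h w

theorem Guarded.inputs {T : SType L V} (h : T.Guarded) :
    ∀ w : List L, (SType.inputs w T).Guarded
  | [] => h
  | _ :: w => fun _ => Guarded.inputs h w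

theorem NonemptyChoices.outputs {T : SType L V} (h : T.NonemptyChoices) :
    ∀ w : List L, (SType.outputs w T).NonemptyChoices
  | [] => h
  | _ :: w => ⟨Finset.singleton_nonempty _, fun _ => NonemptyChoices.outputs h w⟩

theorem NonemptyChoices.inputs {T : SType L V} (h : T.NonemptyChoices) :
    ∀ w : List L, (SType.inputs w T).NonemptyChoices
  | [] => h
  | _ :: w => ⟨Finset.singleton_nonempty _, fun _ => NonemptyChoices.inputs h w⟩

theorem HasInput.outputs {T : SType L V} (h : T.HasInput) :
    ∀ w : List L, (SType.outputs w T).HasInput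
  | [] => h
  | _ :: w => ⟨⟨_, Finset.mem_singleton_self _⟩, HasInput.outputs h w⟩

theorem inputs_append (w₁ w₂ : List L) (T : SType L V) :
    inputs (w₁ ++ w₂) T = inputs w₁ (inputs w₂ T) := by
  induction w₁ with
  | nil => rfl
  | cons C w ih => simp [inputs, ih]

/-- The types into which the recursive tail of a queue encoding may unfold. -/
inductive IsBuffer (I : Finset L) (t : V) : SType L V → Prop
  | mu : IsBuffer I t (mu t (sel I fun A => bra {A.1} fun _ => var t))
  | sel (Z : ↥I → SType L V) (hZ : ∀ A, IsBuffer I t (Z A)) :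
      IsBuffer I t (sel I fun A => bra {A.1} fun _ => Z A)

theorem IsBuffer.eq_sel {I J : Finset L} {t : V} {S : ↥J → SType L V}
    (h : IsBuffer I t (SType.sel J S)) :
    ∃ hJ : J ⊆ I, ∃ Z : ↥I → SType L V, (∀ A, IsBuffer I t (Z A)) ∧
      ∀ A : ↥J, S A = bra {A.1} fun _ => Z ⟨A.1, hJ A.2⟩ := by
  cases h with
  | sel Z hZ => exact ⟨subset_rfl, Z, hZ, fun _ => rfl⟩

/-- An input context that is filled with selections and yields a queue encoding consists of the
whole stored queue. -/
theorem IsBuffer.fill_eq {I : Finset L} {t : V} {m : ℕ} {J : Fin m → Finset L}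
    {S : ∀ h, ↥(J h) → SType L V} (w : List L) {Z : SType L V} (hZ : IsBuffer I t Z)
    (A : InputContext L m) (e : inputs w Z = A.fill fun h => SType.sel (J h) (S h))
    {B : L} (hB : ∀ h, B ∈ J h) :
    w.length ≤ A.depth ∧ ∃ Z', IsBuffer I t Z' ∧
      (A.fill fun h => S h ⟨B, hB h⟩) = inputs (w ++ [B]) Z' := by
  induction w generalizing A with
  | nil =>
    refine ⟨Nat.zero_le _, ?_⟩
    cases A with
    | hole h =>
      simp only [inputs, InputContext.fill] at e
      rw [e] at hZ
      obtain ⟨hJ, Z', hZ', e'⟩ := hZ.eq_sel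
      exact ⟨Z' ⟨B, hJ (hB h)⟩, hZ' _, e' _⟩
    | bra K A =>
      simp only [inputs, InputContext.fill] at e
      rw [e] at hZ
      -- A buffer is a recursion or a selection, so the context cannot reach past the stored word.
      cases hZ
  | cons C w ih =>
    cases A with
    | hole h => simp [inputs, InputContext.fill] at e
    | bra K A =>
      simp only [inputs, InputContext.fill, SType.bra.injEq] at e
      obtain ⟨rfl, e⟩ := e
      have e := congrFun (eq_of_heq e)
      have hu : ∀ i : ↥({C} : Finset L), i = ⟨C, Finset.mem_singleton_self C⟩ := fun i =>
        Subtype.ext (Finset.mem_singleton.1 i.2)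
      obtain ⟨h1, Z', hZ', h2⟩ := ih _ (e ⟨C, Finset.mem_singleton_self C⟩)
      refine ⟨?_, Z', hZ', ?_⟩
      · rw [List.length_cons, InputContext.depth, add_comm]
        exact Nat.add_le_add_left (h1.trans
          (Finset.le_sup (f := fun i => (A i).depth) (Finset.mem_univ _))) _
      · simp only [InputContext.fill, List.cons_append, inputs]
        congr 1
        funext i
        rw [hu i, h2]

variable [DecidableEq V]

/-- The inclusion `X ⊆ insert t Y`, in place of an equality, is what survives the passage under a
binder, whether or not that binder is `t` itself. -/
theorem ClosedIn.subst {T N : SType L V} {t : V} {X Y : Set V} (h : T.ClosedIn X)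
    (hN : N.ClosedIn ∅) (hXY : X ⊆ insert t Y) : (subst t N T).ClosedIn Y := by
  induction T generalizing X Y with
  | sel I T ih => exact fun i => ih i (h i) hXY
  | bra I T ih => exact fun i => ih i (h i) hXY
  | mu u T ih =>
    by_cases hu : u = t
    · simp only [SType.subst, hu, if_true, ClosedIn] at h ⊢
      exact h.mono (Set.insert_subset (Set.mem_insert _ _) hXY)
    · simp only [SType.subst, hu, if_false, ClosedIn] at h ⊢
      refine ih h ?_
      rw [Set.insert_comm]
      exact Set.insert_subset_insert hXY
  | var u =>
    by_cases hu : u = t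
    · simp only [SType.subst, hu, if_true]
      exact hN.mono (Set.empty_subset _)
    · simp only [SType.subst, hu, if_false]
      exact (hXY h).resolve_left hu
  | endT => trivial

theorem subst_eq_self {T N : SType L V} {t : V} {X : Set V} (h : T.ClosedIn X) (ht : t ∉ X) :
    subst t N T = T := by
  induction T generalizing X with
  | sel I T ih => exact congrArg _ (funext fun i => ih i (h i) ht)
  | bra I T ih => exact congrArg _ (funext fun i => ih i (h i) ht)
  | mu u T ih =>
    by_cases hu : u = t
    · simp [SType.subst, hu]
    · simp only [SType.subst, hu, if_false]
      rw [ih h (by simp [ht, Ne.symm hu])]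
  | var u =>
    have hu : u ≠ t := fun e => ht (e ▸ h)
    simp [SType.subst, hu]
  | endT => rfl

theorem subst_outputs (t : V) (N T : SType L V) (w : List L) :
    subst t N (outputs w T) = outputs w (subst t N T) := by
  induction w with
  | nil => rfl
  | cons B w ih => simp [outputs, subst, ih]

theorem HasInput.subst {T N : SType L V} {t : V} (h : T.HasInput) :
    (SType.subst t N T).HasInput := by
  induction T with
  | sel I T ih => exact h.imp fun i hi => ih i hi
  | bra I T ih => trivial
  | mu u T ih =>
    simp only [SType.subst]
    split
    · exact h
    · exact ih h
  | var u => exact h.elim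
  | endT => exact h.elim

theorem unfold_inputs (n : ℕ) (w : List L) (T : SType L V) :
    unfold n (inputs w T) = inputs w (unfold n T) := by
  have key : ∀ (w : List L) (T : SType L V),
      unfoldOnce (inputs w T) = inputs w (unfoldOnce T) := by
    intro w T
    induction w with
    | nil => rfl
    | cons C w ih => simp [inputs, unfoldOnce, ih]
  induction n with
  | zero => rfl
  | succ n ih => rw [unfold, ih, key, unfold]

theorem IsBuffer.unfold {I : Finset L} {t : V} {Z : SType L V} (h : IsBuffer I t Z) (n : ℕ) :
    IsBuffer I t (unfold n Z) := by
  have key : ∀ Z, IsBuffer I t Z → IsBuffer I t (unfoldOnce Z) := by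
    intro Z h
    induction h with
    | mu =>
      simp only [unfoldOnce, SType.subst, if_true]
      exact .sel _ fun _ => .mu
    | sel Z hZ ih => exact .sel _ ih
  induction n with
  | zero => exact h
  | succ n ih => exact key _ ih

end SType

/-! ### Linear input contexts -/

namespace InputContext

variable {L : Type u} {V : Type v}

/-- The linear input context that reads the word `w`. -/
def ofList : List L → InputContext L 1
  | [] => .hole 0
  | C :: w => .bra {C} fun _ => InputContext.ofList w

theorem fill_ofList (w : List L) (T : Fin 1 → SType L V) :
    (InputContext.ofList w).fill T = SType.inputs w (T 0) := by
  induction w with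
  | nil => rfl
  | cons C w ih => simp [InputContext.ofList, fill, SType.inputs, ih]

theorem depth_ofList (w : List L) :
    (InputContext.ofList w).depth = w.length := by
  induction w with
  | nil => rfl
  | cons C w ih =>
    rw [InputContext.ofList, InputContext.depth, ih, List.length_cons, add_comm,
      Finset.sup_const ⟨⟨C, Finset.mem_singleton_self C⟩, Finset.mem_univ _⟩]

theorem wellFormed_ofList (w : List L) :
    (InputContext.ofList w).WellFormed := by
  refine ⟨le_rfl, fun k => ?_⟩
  induction w with
  | nil => simp [InputContext.ofList, InputContext.holeCount, Subsingleton.elim k 0]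
  | cons C w ih => simp [InputContext.ofList, InputContext.holeCount, ih]

end InputContext

/-! ### Control encodings as closed types -/

namespace QueueMachine

open SType

variable {L : Type u} {V : Type v}

theorem isSessionType_encodeQueue (M : QueueMachine L V) (t : V) (w : List ↥M.queueAlphabet) :
    (M.encodeQueue t w).IsSessionType := by
  refine ⟨ClosedIn.inputs ?_ _, Guarded.inputs ?_ _, NonemptyChoices.inputs ?_ _⟩
  · exact fun _ _ => Set.mem_insert _ _
  · exact ⟨id, fun _ _ => trivial⟩
  · exact ⟨⟨_, M.initSymbol_mem⟩, fun _ => ⟨Finset.singleton_nonempty _, fun _ => trivial⟩⟩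

variable [DecidableEq V] (M : QueueMachine L V)

theorem encodeControl_closedIn (X : Finset ↥M.states) (q : ↥M.states) :
    (M.encodeControl X q).ClosedIn (Subtype.val '' (X : Set ↥M.states)) := by
  induction X, q using encodeControl.induct M with
  | case1 X q h =>
    rw [encodeControl, if_pos h]
    exact ⟨q, h, rfl⟩
  | case2 X q h ih =>
    rw [encodeControl, if_neg h]
    intro A
    refine ClosedIn.outputs ?_ _
    have := ih A
    rwa [Finset.coe_insert, Set.image_insert_eq] at this

theorem encodeControl_guarded (X : Finset ↥M.states) (q : ↥M.states) :
    (M.encodeControl X q).Guarded := by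
  induction X, q using encodeControl.induct M with
  | case1 X q h =>
    rw [encodeControl, if_pos h]
    trivial
  | case2 X q h ih =>
    rw [encodeControl, if_neg h]
    exact ⟨id, fun A => Guarded.outputs (ih A) _⟩

theorem encodeControl_nonemptyChoices (X : Finset ↥M.states) (q : ↥M.states) :
    (M.encodeControl X q).NonemptyChoices := by
  induction X, q using encodeControl.induct M with
  | case1 X q h =>
    rw [encodeControl, if_pos h]
    trivial
  | case2 X q h ih =>
    rw [encodeControl, if_neg h]
    exact ⟨⟨_, M.initSymbol_mem⟩, fun A => NonemptyChoices.outputs (ih A) _⟩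

theorem isSessionType_encodeControl (q : ↥M.states) :
    (M.encodeControl ∅ q).IsSessionType := by
  refine ⟨?_, M.encodeControl_guarded _ _, M.encodeControl_nonemptyChoices _ _⟩
  simpa using M.encodeControl_closedIn ∅ q

/-- `f` closes types over `X` by substituting control types for the states in `X`, in the order in
which the recursions were unfolded. -/
inductive IsEnv : Finset ↥M.states → (SType L V → SType L V) → Prop
  | nil : IsEnv ∅ id
  | cons {X f q} (h : IsEnv X f) (hq : q ∉ X) :
      IsEnv (insert q X) fun T => subst q.1 (f (M.encodeControl X q)) (f T)

/-- The closed types that represent the control state `q`. -/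
def IsControl (q : ↥M.states) (C : SType L V) : Prop :=
  ∃ X f, M.IsEnv X f ∧ q ∉ X ∧ C = f (M.encodeControl X q)

variable {M} {X : Finset ↥M.states} {f : SType L V → SType L V}

theorem IsEnv.map_bra (h : M.IsEnv X f) (I : Finset L) (T : ↥I → SType L V) :
    f (bra I T) = bra I fun i => f (T i) := by
  induction h with
  | nil => rfl
  | cons h hq ih => simp only [ih, subst]

theorem IsEnv.map_outputs (h : M.IsEnv X f) (w : List L) (T : SType L V) :
    f (outputs w T) = outputs w (f T) := by
  induction h with
  | nil => rfl
  | cons h hq ih => simp only [ih, subst_outputs]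

theorem IsEnv.map_mu (h : M.IsEnv X f) {q : ↥M.states} (hq : q ∉ X) (T : SType L V) :
    f (mu q.1 T) = mu q.1 (f T) := by
  induction h with
  | nil => rfl
  | @cons X f p h hp ih =>
    rw [Finset.mem_insert, not_or] at hq
    have : q.1 ≠ p.1 := fun e => hq.1 (Subtype.ext e)
    simp only [ih hq.2, subst, if_neg this]

theorem IsEnv.map_var (h : M.IsEnv X f) {q : ↥M.states} (hq : q ∉ X) :
    f (var q.1) = var q.1 := by
  induction h with
  | nil => rfl
  | @cons X f p h hp ih =>
    rw [Finset.mem_insert, not_or] at hq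
    have : q.1 ≠ p.1 := fun e => hq.1 (Subtype.ext e)
    simp only [ih hq.2, subst, if_neg this]

theorem IsEnv.closedIn (h : M.IsEnv X f) {T : SType L V}
    (hT : T.ClosedIn (Subtype.val '' (X : Set ↥M.states))) : (f T).ClosedIn ∅ := by
  -- The extra free variables `Y` are needed because the inner substitutions act on a type in which
  -- the state substituted last is still free.
  have key : ∀ {T : SType L V} {Y : Set V},
      T.ClosedIn (Subtype.val '' (X : Set ↥M.states) ∪ Y) → (f T).ClosedIn Y := by
    clear hT
    induction h with
    | nil =>
      intro T Y hT
      simpa using hT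
    | @cons X f p h hp ih =>
      intro T Y hT
      refine ClosedIn.subst (X := insert p.1 Y) (ih ?_) (ih ?_) subset_rfl
      · rwa [Finset.coe_insert, Set.image_insert_eq, Set.insert_union, ← Set.union_insert] at hT
      · simpa using M.encodeControl_closedIn X p
  exact key (by simpa using hT)

/-- If `q` is already bound, its variable is replaced by the closed control type recorded when `q`
was opened; otherwise the type is one by definition. -/
theorem IsEnv.isControl (h : M.IsEnv X f) (q : ↥M.states) :
    M.IsControl q (f (M.encodeControl X q)) := by
  by_cases hq : q ∈ X
  · rw [encodeControl, if_pos hq]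
    induction h with
    | nil => simp at hq
    | @cons X f p h hp ih =>
      by_cases hqp : q = p
      · subst hqp
        refine ⟨X, f, h, hp, ?_⟩
        simp only [h.map_var hp, subst, if_true]
      · have hq' := (Finset.mem_insert.1 hq).resolve_left hqp
        obtain ⟨Y, g, hg, hqY, e⟩ := ih hq'
        refine ⟨Y, g, hg, hqY, ?_⟩
        beta_reduce
        rw [e]
        -- The type substituted earlier is closed, so later substitutions leave it alone.
        exact subst_eq_self (hg.closedIn (M.encodeControl_closedIn Y q)) (Set.notMem_empty _)
  · exact ⟨X, f, h, hq, rfl⟩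

/-- Unfolding the leading recursion extends the environment by exactly the substitution it performs,
so the continuations are again control types, now of the successor states. This closes the class of
control types under machine steps. -/
theorem IsControl.unfold {q : ↥M.states} {C : SType L V} (h : M.IsControl q C) :
    C.HasInput ∧ ∃ body, C = mu q.1 body ∧ ∃ g : ↥M.queueAlphabet → SType L V,
      (∀ A, M.IsControl (M.trans q A).1 (g A)) ∧
      subst q.1 C body = bra M.queueAlphabet fun A =>
        outputs ((M.trans q A).2.map Subtype.val) (g A) := by
  obtain ⟨X, f, hf, hq, rfl⟩ := h
  have e : f (M.encodeControl X q) = mu q.1 (bra M.queueAlphabet fun A =>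
      outputs ((M.trans q A).2.map Subtype.val)
        (f (M.encodeControl (insert q X) (M.trans q A).1))) := by
    conv_lhs => rw [encodeControl, if_neg hq]
    rw [hf.map_mu hq, hf.map_bra]
    simp only [hf.map_outputs]
  refine ⟨by rw [e]; trivial, _, e, fun A => subst q.1 (f (M.encodeControl X q))
    (f (M.encodeControl (insert q X) (M.trans q A).1)), fun A => (hf.cons hq).isControl _, ?_⟩
  simp only [subst, subst_outputs]

theorem isControl_encodeControl (q : ↥M.states) : M.IsControl q (M.encodeControl ∅ q) :=
  IsEnv.nil.isControl q

/-! ### From subtyping to a non-terminating bounded run -/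

section Soundness

variable {k : ℕ} {R : SType L V → SType L V → Prop} {t : V}

/-- Each output forces an input context at least as deep as the queue is long, so before it the
length is at most `k` and after it at most `k + 1`. For empty `w` only the old length bounds the
queue, whence the maximum. -/
theorem outputs_of_isBoundedSubtypingRel (hR : IsBoundedSubtypingRel k R) {I : Finset L}
    {C : SType L V} (w γ : List L) {Z : SType L V} (hZ : IsBuffer I t Z)
    (h : R (outputs w C) (inputs γ Z)) :
    (γ ++ w).length ≤ max (k + 1) γ.length ∧
      ∃ Z', IsBuffer I t Z' ∧ R C (inputs (γ ++ w) Z') := by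
  induction w generalizing γ Z with
  | nil => exact ⟨by simp, Z, hZ, by simpa [outputs] using h⟩
  | cons B w ih =>
    obtain ⟨n, m, A, J, S', hJ, -, hd, e, hT, -⟩ := hR.sel _ _ _ h
    rw [unfold_inputs] at e
    have hB := Finset.mem_singleton_self B
    obtain ⟨hl, Z', hZ', e'⟩ := (hZ.unfold n).fill_eq γ A e fun h => hJ h hB
    have h' := hT ⟨B, hB⟩
    rw [e'] at h'
    obtain ⟨hl', Z'', hZ'', h''⟩ := ih (γ ++ [B]) hZ' h'
    rw [List.append_assoc] at hl' h''
    simp only [List.length_append, List.length_cons, List.length_nil] at hl' ⊢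
    exact ⟨by omega, Z'', hZ'', h''⟩

theorem bra_of_isBoundedSubtypingRel (hR : IsBoundedSubtypingRel k R) {I J : Finset L}
    {T : ↥I → SType L V} {γ : List L} {Z : SType L V} (hZ : IsBuffer J t Z)
    (h : R (bra I T) (inputs γ Z)) :
    ∃ (B : L) (γ' : List L) (hB : B ∈ I) (Z' : SType L V), γ = B :: γ' ∧ IsBuffer J t Z' ∧
      R (T ⟨B, hB⟩) (inputs γ' Z') := by
  obtain ⟨n, K, S, hK, e, hS⟩ := hR.bra _ _ _ h
  rw [unfold_inputs] at e
  have hZ' := hZ.unfold n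
  cases γ with
  | nil =>
    simp only [inputs] at e
    rw [e] at hZ'
    cases hZ'
  | cons B γ =>
    simp only [inputs, SType.bra.injEq] at e
    obtain ⟨rfl, e⟩ := e
    obtain rfl := eq_of_heq e
    exact ⟨B, γ, _, _, rfl, hZ', hS ⟨B, Finset.mem_singleton_self B⟩⟩

/-- The invariant of the run: control type against stored word stays in `R`. The buffer is only
known up to unfolding, because each rule may unfold the right-hand type arbitrarily often. -/
theorem exists_isControl_of_reaches (hR : IsBoundedSubtypingRel k R) {c d : M.Config}
    (hcd : Relation.ReflTransGen M.Step c d)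
    (h : R (M.encodeControl ∅ c.1) (M.encodeQueue t c.2)) :
    d.2.length ≤ max (k + 1) c.2.length ∧ ∃ C Z, M.IsControl d.1 C ∧
      IsBuffer M.queueAlphabet t Z ∧ R C (inputs (d.2.map Subtype.val) Z) := by
  induction hcd with
  | refl => exact ⟨by simp, _, _, isControl_encodeControl _, .mu, h⟩
  | tail _ hs ih =>
    cases hs with
    | mk p A α =>
      obtain ⟨hl, C, Z, hC, hZ, h⟩ := ih
      obtain ⟨-, body, hb, g, hg, e⟩ := hC.unfold
      rw [hb] at h
      have h := hR.mu _ _ _ h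
      rw [← hb, e] at h
      obtain ⟨B, γ', hB, Z', e', hZ', h'⟩ := bra_of_isBoundedSubtypingRel hR hZ h
      simp only [List.map_cons, List.cons.injEq] at e'
      obtain ⟨rfl, rfl⟩ := e'
      obtain ⟨hl', Z'', hZ'', h''⟩ := outputs_of_isBoundedSubtypingRel hR _ _ hZ' h'
      simp only [List.length_append, List.length_map, List.length_cons] at hl hl' ⊢
      refine ⟨?_, _, Z'', hg A, hZ'', by simpa using h''⟩
      exact hl'.trans (max_le (le_max_left _ _) ((Nat.le_succ _).trans hl))

/-- With nothing stored, the control type's input would have to be matched by an unfolded buffer,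
which is never a branching. -/
theorem ne_nil_of_isBoundedSubtypingRel (hR : IsBoundedSubtypingRel k R) {q : ↥M.states}
    {C Z : SType L V} (hC : M.IsControl q C) (hZ : IsBuffer M.queueAlphabet t Z) :
    ¬ R C (inputs [] Z) := by
  intro h
  obtain ⟨-, body, hb, g, hg, e⟩ := hC.unfold
  rw [hb] at h
  have h := hR.mu _ _ _ h
  rw [← hb, e] at h
  obtain ⟨B, γ', hB, Z', e', -⟩ := bra_of_isBoundedSubtypingRel hR hZ h
  cases e'

end Soundness

/-! ### From a non-terminating bounded run to subtyping -/

/-- The pairs of types that arise while the machine runs from the configuration `c`. -/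
inductive SimRel (c : M.Config) (t : V) : SType L V → SType L V → Prop
  | outputs {q C} (hC : M.IsControl q C) (w γ : List ↥M.queueAlphabet)
      (h : Relation.ReflTransGen M.Step c (q, γ ++ w)) :
      SimRel c t (outputs (w.map Subtype.val) C) (M.encodeQueue t γ)
  | bra (q : ↥M.states) (g : ↥M.queueAlphabet → SType L V)
      (hg : ∀ A, M.IsControl (M.trans q A).1 (g A)) (γ : List ↥M.queueAlphabet)
      (h : Relation.ReflTransGen M.Step c (q, γ)) :
      SimRel c t (bra M.queueAlphabet fun A => SType.outputs ((M.trans q A).2.map Subtype.val) (g A))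
        (M.encodeQueue t γ)

/-- A machine step appends its word at once, the types letter by letter. Pending outputs `w` and
stored word `γ` are therefore matched with the configuration whose queue is already `γ ++ w`, and
the context depth `γ.length` is at most `k`. -/
theorem isBoundedSubtypingRel_simRel {c : M.Config} {t : V} {k : ℕ}
    (hc : ∀ q γ, Relation.ReflTransGen M.Step c (q, γ) → γ ≠ [] ∧ γ.length ≤ k) :
    IsBoundedSubtypingRel k (SimRel c t) where
  endT S h := by
    generalize hT : SType.endT = T at h
    cases h with
    | outputs hC w γ h =>
      cases w with
      | nil =>
        obtain ⟨-, body, hb, -⟩ := hC.unfold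
        simp [SType.outputs, hb] at hT
      | cons B w => cases hT
    | bra q g hg γ h => cases hT
  sel I T S h := by
    generalize hT : SType.sel I T = T' at h
    cases h with
    | @outputs q C hC w γ h =>
      cases w with
      | nil =>
        obtain ⟨-, body, hb, -⟩ := hC.unfold
        simp [SType.outputs, hb] at hT
      | cons B w =>
        simp only [List.map_cons, SType.outputs, SType.sel.injEq] at hT
        obtain ⟨rfl, hT⟩ := hT
        obtain rfl := eq_of_heq hT
        -- One unfolding exposes the selection of the buffer and leaves a folded copy behind each
        -- output, so the result is again a queue encoding.
        refine ⟨1, 1, .ofList (γ.map Subtype.val), fun _ => M.queueAlphabet,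
          fun _ A => SType.bra {A.1} fun _ =>
            SType.mu t (SType.sel M.queueAlphabet fun A => SType.bra {A.1} fun _ => SType.var t),
          fun _ => Finset.singleton_subset_iff.2 B.2, InputContext.wellFormed_ofList _, ?_, ?_, ?_, ?_⟩
        · have := (hc _ _ h).2
          rw [InputContext.depth_ofList, List.length_map]
          simp only [List.length_append] at this
          omega
        · rw [encodeQueue, unfold_inputs, InputContext.fill_ofList]
          simp [SType.unfold, SType.unfoldOnce, SType.subst]
        · rintro ⟨i, hi⟩
          obtain rfl := Finset.mem_singleton.1 hi
          rw [InputContext.fill_ofList]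
          have h' : Relation.ReflTransGen M.Step c (q, (γ ++ [B]) ++ w) := by simpa using h
          have := SimRel.outputs (t := t) hC w (γ ++ [B]) h'
          rwa [encodeQueue, List.map_append, inputs_append] at this
        · intro _ _
          exact HasInput.outputs hC.unfold.1 _
    | bra q g hg γ h => cases hT
  bra I T S h := by
    generalize hT : SType.bra I T = T' at h
    cases h with
    | outputs hC w γ h =>
      cases w with
      | nil =>
        obtain ⟨-, body, hb, -⟩ := hC.unfold
        simp [SType.outputs, hb] at hT
      | cons B w => cases hT
    | bra q g hg γ h =>
      simp only [SType.bra.injEq] at hT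
      obtain ⟨rfl, hT⟩ := hT
      obtain rfl := eq_of_heq hT
      cases γ with
      | nil => exact ((hc _ _ h).1 rfl).elim
      | cons A γ =>
        refine ⟨0, {A.1}, fun _ => M.encodeQueue t γ, Finset.singleton_subset_iff.2 A.2, rfl, ?_⟩
        rintro ⟨i, hi⟩
        obtain rfl := Finset.mem_singleton.1 hi
        exact .outputs (hg A) _ _ (h.tail (.mk q A γ))
  mu s T S h := by
    generalize hT : SType.mu s T = T' at h
    cases h with
    | outputs hC w γ h =>
      cases w with
      | nil =>
        obtain ⟨-, body, hb, g, hg, e⟩ := hC.unfold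
        simp only [List.map_nil, SType.outputs] at hT
        rw [hb, SType.mu.injEq] at hT
        obtain ⟨rfl, rfl⟩ := hT
        simp only [List.map_nil, SType.outputs]
        rw [e]
        exact .bra _ g hg γ (by simpa using h)
      | cons B w => cases hT
    | bra q g hg γ h => cases hT

theorem boundedSubtype_iff (M : QueueMachine L V) (x : List ↥M.inputAlphabet) (t : V) :
    BoundedSubtype (M.encodeControl ∅ M.start) (M.encodeQueue t (M.initQueue x)) ↔
      ¬ M.TerminatesOn x ∧ M.BoundOn x := by
  constructor
  · rintro ⟨k, R, hR, h⟩
    refine ⟨?_, max (k + 1) (M.initQueue x).length, fun q γ hr =>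
      (exists_isControl_of_reaches hR hr h).1⟩
    rintro ⟨q, hr⟩
    obtain ⟨-, C, Z, hC, hZ, h'⟩ := exists_isControl_of_reaches hR hr h
    exact ne_nil_of_isBoundedSubtypingRel hR hC hZ h'
  · rintro ⟨ht, k, hk⟩
    refine ⟨k, _, isBoundedSubtypingRel_simRel (c := (M.start, M.initQueue x)) (t := t) ?_, ?_⟩
    · intro q γ hr
      refine ⟨?_, hk q γ hr⟩
      rintro rfl
      exact ht ⟨q, hr⟩
    · exact .outputs (isControl_encodeControl M.start) [] _ (by rw [List.append_nil])

end QueueMachine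

/-! ### Queue systems and their looping behaviour -/

/-- A queue system: the transition function of a queue machine, over arbitrary types. -/
abbrev QueueSystem (Q A : Type*) := Q → A → Q × List A

namespace QueueSystem

variable {Q A : Type*}

/-- One transition of a queue system. -/
inductive Step (δ : QueueSystem Q A) : Q × List A → Q × List A → Prop
  | mk (p : Q) (a : A) (w : List A) : Step δ (p, a :: w) ((δ p a).1, w ++ (δ p a).2)

/-- The reachability relation of a queue system. -/
abbrev Reaches (δ : QueueSystem Q A) := Relation.ReflTransGen δ.Step

/-- From `c`, the queue never becomes empty and stays bounded. -/
def LoopsFrom (δ : QueueSystem Q A) (c : Q × List A) : Prop :=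
  ∃ k, ∀ d, δ.Reaches c d → d.2 ≠ [] ∧ d.2.length ≤ k

variable {δ : QueueSystem Q A}

theorem LoopsFrom.of_reaches {c d : Q × List A} (h : δ.Reaches c d) (hd : δ.LoopsFrom d) :
    δ.LoopsFrom c := by
  induction h using Relation.ReflTransGen.head_induction_on with
  | refl => exact hd
  | head hs _ ih =>
    cases hs with
    | mk p a w =>
      obtain ⟨k, hk⟩ := ih
      -- Transitions are deterministic, so only the current queue, of length `w.length + 1`, is
      -- added to those reachable from the successor.
      refine ⟨max k (w.length + 1), fun e he => ?_⟩
      rcases he.cases_head with rfl | ⟨e', hs', he'⟩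
      · simp
      · cases hs'
        exact ⟨(hk e he').1, (hk e he').2.trans (le_max_left _ _)⟩

theorem loopsFrom_of_rotating {p : Q} (hp : ∀ a, δ p a = (p, [a])) {w : List A} (hw : w ≠ []) :
    δ.LoopsFrom (p, w) := by
  have key : ∀ d, δ.Reaches (p, w) d → d.1 = p ∧ d.2.length = w.length := by
    intro d hd
    induction hd with
    | refl => exact ⟨rfl, rfl⟩
    | tail _ hs ih =>
      cases hs with
      | mk p' a w' =>
        obtain ⟨rfl, h⟩ := ih
        simpa [hp] using h
  refine ⟨w.length, fun d hd => ⟨fun h => hw ?_, (key d hd).2.le⟩⟩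
  have := (key d hd).2
  rw [h] at this
  exact List.length_eq_zero_iff.1 this.symm

theorem reaches_copy {p : Q} {u : List A} (hp : ∀ a ∈ u, δ p a = (p, [a])) (w : List A) :
    δ.Reaches (p, u ++ w) (p, w ++ u) := by
  induction u generalizing w with
  | nil => rw [List.nil_append, List.append_nil]
  | cons a u ih =>
    refine .head (b := (p, u ++ (w ++ [a]))) ?_ ?_
    · have := Step.mk (δ := δ) p a (u ++ w)
      rw [hp a (List.mem_cons_self)] at this
      simpa using this
    · have := ih (fun b hb => hp b (List.mem_cons_of_mem _ hb)) (w ++ [a])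
      simpa using this

/-! ### Queue systems as queue machines over the natural numbers -/

section Realization

variable [Fintype A] (δ : QueueSystem Q A) (S : Finset Q)
  (hS : ∀ p ∈ S, ∀ a, (δ p a).1 ∈ S) (p₀ : ↥S) (z : A)

/-- The numbering of the states. -/
noncomputable def stateEquiv : ↥S ≃ ↥(Finset.range S.card) :=
  S.equivFin.trans ⟨fun i => ⟨i.1, Finset.mem_range.2 i.2⟩, fun i => ⟨i.1, Finset.mem_range.1 i.2⟩,
    fun _ => rfl, fun _ => rfl⟩

variable (A) in
/-- The numbering of the queue symbols. -/
noncomputable def symbolEquiv : A ≃ ↥(Finset.range (Fintype.card A)) :=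
  (Fintype.equivFin A).trans ⟨fun i => ⟨i.1, Finset.mem_range.2 i.2⟩,
    fun i => ⟨i.1, Finset.mem_range.1 i.2⟩, fun _ => rfl, fun _ => rfl⟩

/-- The queue machine over `ℕ` that realizes a queue system on a finite invariant set of states,
with initial queue symbol `z`. -/
noncomputable def toMachine : QueueMachine ℕ ℕ where
  states := Finset.range S.card
  inputAlphabet := (Finset.range (Fintype.card A)).erase (symbolEquiv A z)
  queueAlphabet := Finset.range (Fintype.card A)
  input_subset := Finset.erase_subset _ _
  initSymbol := symbolEquiv A z
  initSymbol_mem := (symbolEquiv A z).2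
  initSymbol_notMem := Finset.notMem_erase _ _
  start := stateEquiv S p₀
  trans p a :=
    let r := δ ((stateEquiv S).symm p) ((symbolEquiv A).symm a)
    (stateEquiv S ⟨r.1, hS _ ((stateEquiv S).symm p).2 _⟩, r.2.map (symbolEquiv A))

/-- The input word that stands for a word without `z`. -/
noncomputable def toInput (u : List A) (hu : z ∉ u) :
    List ↥(δ.toMachine S hS p₀ z).inputAlphabet :=
  u.attach.map fun a => ⟨symbolEquiv A a.1, Finset.mem_erase.2
    ⟨fun h => hu ((symbolEquiv A).injective (Subtype.ext h) ▸ a.2), (symbolEquiv A a.1).2⟩⟩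

theorem initQueue_toInput (u : List A) (hu : z ∉ u) :
    (δ.toMachine S hS p₀ z).initQueue (δ.toInput S hS p₀ z u hu) =
      (u ++ [z]).map (symbolEquiv A) := by
  simp only [QueueMachine.initQueue, toInput, List.map_map, List.map_append, List.map_cons,
    List.map_nil]
  congr 1
  conv_rhs => rw [← List.attach_map_subtype_val u, List.map_map]
  rfl

/-- The queue content that a machine's queue content stands for. -/
noncomputable def ofQueue (w : List ↥(δ.toMachine S hS p₀ z).queueAlphabet) : List A :=
  List.map (symbolEquiv A).symm w

/-- The configuration of the queue system that a machine configuration stands for. -/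
noncomputable def ofConfig (c : (δ.toMachine S hS p₀ z).Config) : Q × List A :=
  (((stateEquiv S).symm c.1).1, δ.ofQueue S hS p₀ z c.2)

variable {δ S hS p₀ z}

theorem length_ofQueue (w : List ↥(δ.toMachine S hS p₀ z).queueAlphabet) :
    (δ.ofQueue S hS p₀ z w).length = w.length :=
  List.length_map _

theorem ofConfig_step (p : ↥(δ.toMachine S hS p₀ z).states)
    (a : ↥(δ.toMachine S hS p₀ z).queueAlphabet)
    (w : List ↥(δ.toMachine S hS p₀ z).queueAlphabet) :
    δ.ofConfig S hS p₀ z (((δ.toMachine S hS p₀ z).trans p a).1,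
        w ++ ((δ.toMachine S hS p₀ z).trans p a).2) =
      ((δ ((stateEquiv S).symm p) ((symbolEquiv A).symm a)).1,
        δ.ofQueue S hS p₀ z w ++ (δ ((stateEquiv S).symm p) ((symbolEquiv A).symm a)).2) := by
  refine Prod.ext ?_ ((List.map_append ..).trans (congrArg _ ?_))
  · exact congrArg Subtype.val ((stateEquiv S).symm_apply_apply _)
  · exact (List.map_map ..).trans (by simp)

theorem step_ofConfig {c d : (δ.toMachine S hS p₀ z).Config}
    (h : (δ.toMachine S hS p₀ z).Step c d) :
    δ.Step (δ.ofConfig S hS p₀ z c) (δ.ofConfig S hS p₀ z d) := by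
  cases h with
  | mk p a w =>
    rw [ofConfig_step]
    exact .mk _ _ _

theorem exists_step_of_step_ofConfig {c : (δ.toMachine S hS p₀ z).Config} {d : Q × List A}
    (h : δ.Step (δ.ofConfig S hS p₀ z c) d) :
    ∃ d', (δ.toMachine S hS p₀ z).Step c d' ∧ δ.ofConfig S hS p₀ z d' = d := by
  obtain ⟨p, w⟩ := c
  cases w with
  | nil => cases h
  | cons a w =>
    refine ⟨_, .mk p a w, ?_⟩
    rw [ofConfig_step]
    cases h
    rfl

theorem loopsFrom_iff (u : List A) (hu : z ∉ u) :
    δ.LoopsFrom (p₀.1, u ++ [z]) ↔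
      ¬ (δ.toMachine S hS p₀ z).TerminatesOn (δ.toInput S hS p₀ z u hu) ∧
        (δ.toMachine S hS p₀ z).BoundOn (δ.toInput S hS p₀ z u hu) := by
  have e : δ.ofConfig S hS p₀ z ((δ.toMachine S hS p₀ z).start,
      (δ.toMachine S hS p₀ z).initQueue (δ.toInput S hS p₀ z u hu)) = (p₀.1, u ++ [z]) := by
    rw [initQueue_toInput]
    refine Prod.ext (congrArg Subtype.val ((stateEquiv S).symm_apply_apply _)) ?_
    exact (List.map_map ..).trans (by simp)
  have h1 : ∀ d, (δ.toMachine S hS p₀ z).Reaches (δ.toInput S hS p₀ z u hu) d →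
      δ.Reaches (p₀.1, u ++ [z]) (δ.ofConfig S hS p₀ z d) := by
    intro d hd
    rw [← e]
    induction hd with
    | refl => exact .refl
    | tail _ hs ih => exact ih.tail (step_ofConfig hs)
  have h2 : ∀ d, δ.Reaches (p₀.1, u ++ [z]) d →
      ∃ d', (δ.toMachine S hS p₀ z).Reaches (δ.toInput S hS p₀ z u hu) d' ∧
        δ.ofConfig S hS p₀ z d' = d := by
    intro d hd
    induction hd with
    | refl => exact ⟨_, .refl, e⟩
    | tail _ hs ih =>
      obtain ⟨c', hc, rfl⟩ := ih
      obtain ⟨d', hd', rfl⟩ := exists_step_of_step_ofConfig hs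
      exact ⟨d', hc.tail hd', rfl⟩
  constructor
  · rintro ⟨k, hk⟩
    refine ⟨?_, k, fun q γ hr => length_ofQueue γ ▸ (hk _ (h1 _ hr)).2⟩
    rintro ⟨q, hr⟩
    exact (hk _ (h1 _ hr)).1 rfl
  · rintro ⟨ht, k, hk⟩
    refine ⟨k, fun d hd => ?_⟩
    obtain ⟨⟨q, γ⟩, hr, rfl⟩ := h2 d hd
    refine ⟨fun h => ht ⟨q, ?_⟩, (length_ofQueue γ).trans_le (hk q γ hr)⟩
    obtain rfl : γ = [] := List.map_eq_nil_iff.1 h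
    exact hr

end Realization

end QueueSystem

/-! ### Simulating stacks by sweeps over a queue -/

/-- A program on stacks of symbols from `G`, indexed by `K`, with control points `P`: at each point
it halts, or replaces the top of some stack by a word that may depend on it. -/
abbrev StackProgram (P K G : Type*) := P → Option (K × (Option G → List G × P))

namespace StackProgram

variable {P K G : Type*}

/-- Queue symbols: `none` marks the end of a sweep, `some none` is a dummy, and the others are
stack symbols tagged with their stack. -/
abbrev Sym (K G : Type*) := Option (Option (K × G))

/-- The tagged version of a word on the stack `k`. -/
def tag (k : K) (l : List G) : List (Sym K G) := l.map fun a => some (some (k, a))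

theorem none_notMem_tag (k : K) (l : List G) : none ∉ tag k l := by simp [tag]

variable [DecidableEq K]

/-- The content of stack `k` that is stored in a queue. -/
def proj (k : K) (u : List (Sym K G)) : List G :=
  u.filterMap fun s => s.bind fun s => s.bind fun s => if s.1 = k then some s.2 else none

/-- The queue system that simulates a stack program, each instruction by one sweep over the queue
that also adds a dummy. In a state `(p, false)` the instruction at `p` is still to be done in this
sweep, in `(p, true)` the rest of the queue is only copied. -/
def toQueueSystem (I : StackProgram P K G) : QueueSystem (P × Bool) (Sym K G)
  | (p, true), none => ((p, false), [some none, none])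
  | (p, true), some s => ((p, true), [some s])
  | (p, false), s =>
    match I p with
    | none => ((p, false), [s])
    | some (k, f) =>
      match s with
      | none => (((f none).2, false), tag k (f none).1 ++ [some none, none])
      | some none => ((p, false), [some none])
      | some (some (k', a)) =>
        if k' = k then (((f (some a)).2, true), tag k (f (some a)).1)
        else ((p, false), [some (some (k', a))])

variable {I : StackProgram P K G}

@[simp]
theorem proj_nil (k : K) : proj k ([] : List (Sym K G)) = [] := rfl

theorem proj_append (k : K) (u v : List (Sym K G)) : proj k (u ++ v) = proj k u ++ proj k v :=
  List.filterMap_append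

theorem proj_tag (j k : K) (l : List G) : proj j (tag k l) = if k = j then l else [] := by
  rw [proj, tag, List.filterMap_map]
  split
  · subst k
    simp
  · simp [*]

theorem proj_cons_stack (j k : K) (a : G) (u : List (Sym K G)) :
    proj j (some (some (k, a)) :: u) = if k = j then a :: proj j u else proj j u := by
  split <;> simp [proj, *]

theorem proj_cons_dummy (j : K) (u : List (Sym K G)) :
    proj j (some none :: u) = proj j u := by
  simp [proj]

/-- The top of stack `k` is the first queue symbol tagged `k`; a sweep copies everything up to it.
-/
theorem proj_eq_nil_or_exists_split (k : K) (u : List (Sym K G)) (hu : none ∉ u) :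
    proj k u = [] ∨
      ∃ u₁ a u₂, u = u₁ ++ some (some (k, a)) :: u₂ ∧ proj k u₁ = [] := by
  induction u with
  | nil => exact .inl rfl
  | cons s u ih =>
    have ih := ih fun h => hu (List.mem_cons_of_mem _ h)
    have hlift : ∀ s, (∀ v, proj k (s :: v) = proj k v) → proj k (s :: u) = [] ∨
        ∃ u₁ a u₂, s :: u = u₁ ++ some (some (k, a)) :: u₂ ∧ proj k u₁ = [] := by
      intro s hs
      rcases ih with h | ⟨u₁, a, u₂, rfl, h⟩
      · exact .inl ((hs _).trans h)
      · exact .inr ⟨s :: u₁, a, u₂, rfl, (hs _).trans h⟩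
    match s with
    | none => exact (hu List.mem_cons_self).elim
    | some none => exact hlift _ fun v => proj_cons_dummy _ _
    | some (some (k', a)) =>
      by_cases hk : k' = k
      · subst hk
        exact .inr ⟨[], a, u, rfl, rfl⟩
      · exact hlift _ fun v => by rw [proj_cons_stack, if_neg hk]

theorem toQueueSystem_copy {p : P} {k : K} {f : Option G → List G × P} (hp : I p = some (k, f))
    {u : List (Sym K G)} (hu : none ∉ u) (hk : proj k u = []) :
    ∀ s ∈ u, I.toQueueSystem (p, false) s = ((p, false), [s]) := by
  intro s hs
  match s with
  | none => exact (hu hs).elim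
  | some none => simp [toQueueSystem, hp]
  | some (some (k', a)) =>
    have : k' ≠ k := by
      rintro rfl
      have := (List.filterMap_eq_nil_iff.1 hk) _ hs
      simp at this
    simp [toQueueSystem, hp, this]

/-- One sweep over the queue carries out one instruction. -/
theorem exists_sweep [DecidableEq G] {p : P} {k : K} {f : Option G → List G × P}
    (hp : I p = some (k, f)) {u : List (Sym K G)} (hu : none ∉ u) :
    ∃ u', none ∉ u' ∧
      I.toQueueSystem.Reaches ((p, false), u ++ [none])
        (((f (proj k u).head?).2, false), u' ++ [none]) ∧
      (fun j => proj j u') = Function.update (fun j => proj j u) k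
        ((f (proj k u).head?).1 ++ (proj k u).tail) ∧
      u.count (some none) < u'.count (some none) := by
  rcases proj_eq_nil_or_exists_split k u hu with hk | ⟨u₁, a, u₂, rfl, hk⟩
  · refine ⟨u ++ tag k (f none).1 ++ [some none], ?_, ?_, ?_, ?_⟩
    · simp [hu, none_notMem_tag]
    · refine (QueueSystem.reaches_copy (toQueueSystem_copy hp hu hk) [none]).tail ?_
      have := QueueSystem.Step.mk (δ := I.toQueueSystem) (p, false) none u
      simpa [toQueueSystem, hp, hk] using this
    · funext j
      simp only [proj_append, proj_tag, proj_cons_dummy, hk]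
      by_cases hj : j = k
      · subst hj
        simp [hk]
      · simp [hj, Ne.symm hj]
    · simp only [List.count_append, List.count_cons_self]
      omega
  · have hu₁ : none ∉ u₁ := fun h => hu (List.mem_append_left _ h)
    have hu₂ : none ∉ u₂ := fun h =>
      hu (List.mem_append_right _ (List.mem_cons_of_mem _ h))
    have hh : proj k (u₁ ++ some (some (k, a)) :: u₂) = a :: proj k u₂ := by
      rw [proj_append, hk, proj_cons_stack, if_pos rfl, List.nil_append]
    rw [hh, List.head?_cons, List.tail_cons]
    set r := f (some a) with hr
    -- The new word takes the place of the old top, so the order inside every stack is preserved.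
    refine ⟨u₁ ++ tag k r.1 ++ u₂ ++ [some none], ?_, ?_, ?_, ?_⟩
    · simp [hu₁, hu₂, none_notMem_tag]
    · have h1 := QueueSystem.reaches_copy (toQueueSystem_copy hp hu₁ hk)
        (some (some (k, a)) :: (u₂ ++ [none]))
      have h2 := QueueSystem.Step.mk (δ := I.toQueueSystem) (p, false) (some (some (k, a)))
        (u₂ ++ [none] ++ u₁)
      have h3 := QueueSystem.reaches_copy (δ := I.toQueueSystem) (p := (r.2, true)) (u := u₂)
        (by
          intro s hs
          cases s with
          | none => exact (hu₂ hs).elim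
          | some s => rfl) ([none] ++ u₁ ++ tag k r.1)
      have h4 := QueueSystem.Step.mk (δ := I.toQueueSystem) (r.2, true) none
        (u₁ ++ tag k r.1 ++ u₂)
      simp only [toQueueSystem, hp, if_true, ← hr, List.append_assoc, List.cons_append,
        List.nil_append] at h1 h2 h3 h4 ⊢
      exact ((h1.tail h2).trans h3).tail h4
    · funext j
      simp only [proj_append, proj_tag, proj_cons_dummy, proj_cons_stack]
      by_cases hj : j = k
      · subst hj
        simp [hk]
      · simp [hj, Ne.symm hj]
    · simp only [List.count_append, List.count_cons, List.count_nil]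
      simp

end StackProgram

/-! ### Multi-stack machines as stack programs -/

open Turing StateTransition

namespace StackProgram

variable {K G Λ σ : Type*}

open scoped Classical in
/-- A finite set of states of the queue system, if the machine stays in the labels `S`. -/
noncomputable def tm2States [Fintype σ] (M : Λ → TM2.Stmt (fun _ : K => G) Λ σ) (S : Finset Λ) :
    Finset ((TM2.Stmt (fun _ : K => G) Λ σ × σ) × Bool) :=
  ((S.biUnion fun l => TM2.stmts₁ (M l)) ×ˢ Finset.univ) ×ˢ Finset.univ

theorem mem_tm2States [Fintype σ] {M : Λ → TM2.Stmt (fun _ : K => G) Λ σ} {S : Finset Λ}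
    {p : (TM2.Stmt (fun _ : K => G) Λ σ × σ) × Bool} :
    p ∈ tm2States M S ↔ ∃ l ∈ S, p.1.1 ∈ TM2.stmts₁ (M l) := by
  simp [tm2States]

variable [Inhabited K]

/-- The program of a multi-stack machine; each control point is a statement, together with the
value of the internal variable. -/
def ofTM2 (M : Λ → TM2.Stmt (fun _ : K => G) Λ σ) :
    StackProgram (TM2.Stmt (fun _ : K => G) Λ σ × σ) K G
  | (.push k f q, v) => some (k, fun o => (f v :: o.toList, (q, v)))
  | (.peek k f q, v) => some (k, fun o => (o.toList, (q, f v o)))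
  | (.pop k f q, v) => some (k, fun o => ([], (q, f v o)))
  | (.load f q, v) => some (default, fun o => (o.toList, (q, f v)))
  | (.branch f q₁ q₂, v) => some (default, fun o => (o.toList, (cond (f v) q₁ q₂, v)))
  | (.goto f, v) => some (default, fun o => (o.toList, (M (f v), v)))
  | (.halt, _) => none

variable {M : Λ → TM2.Stmt (fun _ : K => G) Λ σ}

theorem ofTM2_mem {S : Finset Λ} (hS : ∀ l ∈ S, TM2.SupportsStmt S (M l))
    {q : TM2.Stmt (fun _ : K => G) Λ σ} {v : σ} (hq : ∃ l ∈ S, q ∈ TM2.stmts₁ (M l)) {k : K}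
    {f : Option G → List G × (TM2.Stmt (fun _ : K => G) Λ σ × σ)}
    (h : ofTM2 M (q, v) = some (k, f)) (o : Option G) :
    ∃ l ∈ S, (f o).2.1 ∈ TM2.stmts₁ (M l) := by
  classical
  obtain ⟨l, hl, hq⟩ := hq
  have hs := TM2.stmts₁_supportsStmt_mono hq (hS l hl)
  have hsub := TM2.stmts₁_trans hq
  cases q with
  | goto g =>
    simp only [ofTM2, Option.some.injEq, Prod.mk.injEq] at h
    obtain ⟨rfl, rfl⟩ := h
    exact ⟨_, hs v, TM2.stmts₁_self⟩
  | halt => simp [ofTM2] at h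
  | branch g q₁ q₂ =>
    simp only [ofTM2, Option.some.injEq, Prod.mk.injEq] at h
    obtain ⟨rfl, rfl⟩ := h
    refine ⟨l, hl, hsub ?_⟩
    simp only [TM2.stmts₁, Finset.mem_insert, Finset.mem_union]
    cases g v
    · exact .inr (.inr TM2.stmts₁_self)
    · exact .inr (.inl TM2.stmts₁_self)
  | _ =>
    simp only [ofTM2, Option.some.injEq, Prod.mk.injEq] at h
    obtain ⟨rfl, rfl⟩ := h
    refine ⟨l, hl, hsub ?_⟩
    simp only [TM2.stmts₁, Finset.mem_insert]
    exact .inr TM2.stmts₁_self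

variable [DecidableEq K]

/-- The queue system that simulates a multi-stack machine. -/
abbrev tm2System (M : Λ → TM2.Stmt (fun _ : K => G) Λ σ) :
    QueueSystem ((TM2.Stmt (fun _ : K => G) Λ σ × σ) × Bool) (Sym K G) :=
  (ofTM2 M).toQueueSystem

theorem tm2System_mem [Fintype σ] {S : Finset Λ} (hS : ∀ l ∈ S, TM2.SupportsStmt S (M l)) :
    ∀ p ∈ tm2States M S, ∀ s, (tm2System M p s).1 ∈ tm2States M S := by
  rintro ⟨⟨q, v⟩, b⟩ hp s
  have hq := hp
  rw [mem_tm2States] at hq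
  cases b with
  | true =>
    cases s with
    | none => rwa [mem_tm2States]
    | some s => exact hp
  | false =>
    rw [mem_tm2States]
    simp only [tm2System, toQueueSystem]
    split
    · exact hq
    · rename_i k f h
      split
      · exact ofTM2_mem hS hq h _
      · exact hq
      · split
        · exact ofTM2_mem hS hq h _
        · exact hq

/-- The queue system carries out the statement `q` on the value `v` of the internal variable. -/
def Simulates [DecidableEq G] (M : Λ → TM2.Stmt (fun _ : K => G) Λ σ)
    (q : TM2.Stmt (fun _ : K => G) Λ σ) (v : σ) : Prop :=
  ∀ u : List (Sym K G), none ∉ u → ∃ q' u', none ∉ u' ∧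
    (tm2System M).Reaches (((q, v), false), u ++ [none])
      (((q', (TM2.stepAux q v fun k => proj k u).var), false), u' ++ [none]) ∧
    (fun k => proj k u') = (TM2.stepAux q v fun k => proj k u).stk ∧
    match (TM2.stepAux q v fun k => proj k u).l with
    | none => q' = .halt
    | some l => q' = M l ∧ u.count (some none) < u'.count (some none)

/-- Instructions that change no stack are rendered as replacing a top by itself. -/
theorem head?_toList_append_tail (l : List G) : l.head?.toList ++ l.tail = l := by
  cases l <;> rfl

theorem Simulates.of_next [DecidableEq G] {q : TM2.Stmt (fun _ : K => G) Λ σ} {v : σ} {k : K}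
    {f : Option G → List G × (TM2.Stmt (fun _ : K => G) Λ σ × σ)}
    (hp : ofTM2 M (q, v) = some (k, f)) (ih : ∀ o, Simulates M (f o).2.1 (f o).2.2)
    (e : ∀ S : K → List G, TM2.stepAux q v S =
      TM2.stepAux (f (S k).head?).2.1 (f (S k).head?).2.2
        (Function.update S k ((f (S k).head?).1 ++ (S k).tail))) :
    Simulates M q v := by
  intro u hu
  obtain ⟨u', hu', hr, hpr, hc⟩ := exists_sweep hp hu
  obtain ⟨q', u'', hu'', hr', hpr', hc'⟩ := ih (proj k u).head? u' hu'
  rw [hpr, ← e fun k => proj k u] at hr' hpr' hc'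
  refine ⟨q', u'', hu'', hr.trans hr', hpr', ?_⟩
  split at hc'
  · exact hc'
  · exact ⟨hc'.1, hc.trans hc'.2⟩

/-- Induction on the statement, one sweep per instruction. A jump also costs a sweep, hence every
passage to a next label adds a dummy; `halt` costs none. -/
theorem simulates [DecidableEq G] (q : TM2.Stmt (fun _ : K => G) Λ σ) (v : σ) :
    Simulates M q v := by
  induction q generalizing v with
  | goto f =>
    intro u hu
    obtain ⟨u', hu', hr, hp, hc⟩ := exists_sweep (I := ofTM2 M) (p := (.goto f, v)) rfl hu
    refine ⟨_, u', hu', hr, hp.trans ?_, rfl, hc⟩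
    simp [head?_toList_append_tail]
  | halt => exact fun u hu => ⟨_, u, hu, .refl, rfl, rfl⟩
  | push k f q ih =>
    refine .of_next rfl (fun _ => ih _) fun S => ?_
    simp [head?_toList_append_tail]
  | peek k f q ih =>
    refine .of_next rfl (fun _ => ih _) fun S => ?_
    simp [head?_toList_append_tail]
  | pop k f q ih =>
    refine .of_next rfl (fun _ => ih _) fun S => ?_
    simp
  | load f q ih =>
    refine .of_next rfl (fun _ => ih _) fun S => ?_
    simp [head?_toList_append_tail]
  | branch f q₁ q₂ ih₁ ih₂ =>
    refine .of_next rfl (fun _ => ?_) fun S => ?_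
    · cases h : f v
      · simpa [h] using ih₂ v
      · simpa [h] using ih₁ v
    · cases h : f v <;> simp [h, head?_toList_append_tail]

theorem reaches_step [DecidableEq G] {l : Λ} {v : σ} {u : List (Sym K G)} (hu : none ∉ u)
    {c : TM2.Cfg (fun _ : K => G) Λ σ}
    (h : Reaches (TM2.step M) ⟨some l, v, fun k => proj k u⟩ c) :
    ∃ q' u', none ∉ u' ∧ (tm2System M).Reaches (((M l, v), false), u ++ [none])
        (((q', c.var), false), u' ++ [none]) ∧ (fun k => proj k u') = c.stk ∧
      q' = c.l.elim .halt M := by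
  induction h with
  | refl => exact ⟨_, u, hu, .refl, rfl, rfl⟩
  | @tail b c _ hs ih =>
    obtain ⟨q', u', hu', hr, hp, rfl⟩ := ih
    obtain ⟨_ | l', v', S'⟩ := b
    · simp at hs
    · simp only [TM2.step, Option.mem_def, Option.some.injEq] at hs
      subst hs
      simp only at hp
      subst hp
      obtain ⟨q'', u'', hu'', hr', hp', hc⟩ := simulates (M := M) (M l') v' u' hu'
      refine ⟨q'', u'', hu'', hr.trans hr', hp', ?_⟩
      split at hc
      · simp [*]
      · simp [*]

/-- A machine that never halts passes through infinitely many labels, each bringing a further dummy.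
-/
theorem exists_reaches_count [DecidableEq G] {l : Λ} {v : σ} {u : List (Sym K G)}
    (hu : none ∉ u)
    (h : ∀ c, Reaches (TM2.step M) ⟨some l, v, fun k => proj k u⟩ c → TM2.step M c ≠ none)
    (n : ℕ) :
    ∃ l' v' u', none ∉ u' ∧ (tm2System M).Reaches (((M l, v), false), u ++ [none])
        (((M l', v'), false), u' ++ [none]) ∧
      Reaches (TM2.step M) ⟨some l, v, fun k => proj k u⟩ ⟨some l', v', fun k => proj k u'⟩ ∧
      n ≤ u'.count (some none) := by
  induction n with
  | zero => exact ⟨l, v, u, hu, .refl, .refl, Nat.zero_le _⟩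
  | succ n ih =>
    obtain ⟨l', v', u', hu', hr, hr', hn⟩ := ih
    obtain ⟨q'', u'', hu'', hs, hp', hc⟩ := simulates (M := M) (M l') v' u' hu'
    have hr'' := hr'.tail (c := TM2.stepAux (M l') v' fun k => proj k u') rfl
    have hne := h _ hr''
    generalize (TM2.stepAux (M l') v' fun k => proj k u') = c at *
    obtain ⟨_ | l'', v'', S⟩ := c
    · simp at hne
    · simp only at hc hp' hs
      subst hp'
      obtain ⟨rfl, hc⟩ := hc
      exact ⟨l'', v'', u'', hu'', hr.trans hs, hr'', by omega⟩

/-- The simulating queue system loops exactly if the multi-stack machine halts. -/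
theorem loopsFrom_tm2System_iff [DecidableEq G] (l : Λ) (v : σ) {u : List (Sym K G)}
    (hu : none ∉ u) :
    (tm2System M).LoopsFrom (((M l, v), false), u ++ [none]) ↔
      (eval (TM2.step M) ⟨some l, v, fun k => proj k u⟩).Dom := by
  rw [Part.dom_iff_mem]
  constructor
  · rintro ⟨k, hk⟩
    by_contra hd
    have h : ∀ c, Reaches (TM2.step M) ⟨some l, v, fun k => proj k u⟩ c → TM2.step M c ≠ none :=
      fun c hc e => hd ⟨c, mem_eval.2 ⟨hc, e⟩⟩
    -- More than `k` dummies contradict the length bound `k`.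
    obtain ⟨l', v', u', -, hr, -, hn⟩ := exists_reaches_count hu h (k + 1)
    have h1 := (hk _ hr).2
    have h2 := List.count_le_length (a := (some none : Sym K G)) (l := u')
    simp only [List.length_append] at h1
    omega
  · rintro ⟨c, hc⟩
    obtain ⟨hr, hs⟩ := mem_eval.1 hc
    obtain ⟨q', u', -, hr', -, rfl⟩ := reaches_step hu hr
    obtain ⟨_ | l', v', S⟩ := c
    · exact .of_reaches hr' (QueueSystem.loopsFrom_of_rotating (fun _ => rfl) (by simp))
    · simp at hs

end StackProgram

/-! ### Computability of the reduction -/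

open Turing StateTransition PartrecToTM2

namespace Turing.PartrecToTM2

instance : Fintype K' where
  elems := {.main, .rev, .aux, .stack}
  complete k := by cases k <;> decide

theorem trNat_bit (b : Bool) (n : ℕ) (h : Nat.bit b n ≠ 0) :
    trNat (Nat.bit b n) = cond b Γ'.bit1 Γ'.bit0 :: trNat n := by
  simp only [trNat, ← Num.ofNat'_eq, Num.ofNat'_bit]
  cases b with
  | true => cases Num.ofNat' n <;> rfl
  | false =>
    cases hn : Num.ofNat' n with
    | zero =>
      rw [Num.ofNat'_eq] at hn
      have h0 : n = 0 := by
        have := congrArg (fun m : Num => (m : ℕ)) hn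
        simpa using this
      simp [h0] at h
    | pos p => rfl

/-- The translation of numbers to words over any alphabet is computable. -/
theorem computable_map_trNat {α : Type*} [Primcodable α] (f : Γ' → α) :
    Computable fun n => (trNat n).map f := by
  have key : Primrec₂ fun (_ : Unit) n => (trNat n).map f := by
    -- Course-of-values recursion on binary digits: the list `l` holds the values below `n`, so its
    -- length is `n` and its entry at `n / 2` lacks only the lowest bit. Of `f` only two constants
    -- enter.
    refine Primrec.nat_strong_rec _ (g := fun _ l =>
      if l.length = 0 then some [] else
        (l[l.length / 2]?).map fun w =>
          (if l.length % 2 = 1 then f .bit1 else f .bit0) :: w) ?_ ?_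
    · have hl : Primrec fun p : Unit × List (List α) => p.2.length :=
        Primrec.list_length.comp Primrec.snd
      refine Primrec.ite (PrimrecRel.comp Primrec.eq hl (Primrec.const 0)) (Primrec.const _) ?_
      refine Primrec.option_map (Primrec.list_getElem?.comp Primrec.snd
        (Primrec.nat_div.comp hl (Primrec.const 2))) ?_
      refine Primrec.list_cons.comp (Primrec.ite (PrimrecRel.comp Primrec.eq
        (Primrec.nat_mod.comp (hl.comp Primrec.fst) (Primrec.const 2)) (Primrec.const 1))
        (Primrec.const _) (Primrec.const _)) Primrec.snd
    · intro _ n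
      simp only [List.length_map, List.length_range]
      by_cases hn : n = 0
      · simp [hn]
      · have hlt : n / 2 < n := by omega
        have hb : Nat.bit (n % 2 = 1) (n / 2) = n := by
          rcases Nat.mod_two_eq_zero_or_one n with h | h <;> simp [h, Nat.bit] <;> omega
        have := trNat_bit (n % 2 = 1) (n / 2) (by rwa [hb])
        rw [hb] at this
        rw [if_neg hn, List.getElem?_map, List.getElem?_range hlt, this]
        rcases Nat.mod_two_eq_zero_or_one n with h | h <;> simp [h]
  exact (key.comp (Primrec.const ()) Primrec.id).to_comp

end Turing.PartrecToTM2

namespace SType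

theorem code_inputs (w : List ℕ) (T : SType ℕ ℕ) :
    code (inputs w T) =
      w.foldr (fun C c => Nat.pair 1 (Encodable.encode [(C, c)])) (code T) := by
  induction w with
  | nil => rfl
  | cons C w ih =>
    have h : ((Finset.univ : Finset ↥({C} : Finset ℕ)).sort (· ≤ ·)) =
        [⟨C, Finset.mem_singleton_self C⟩] := by
      rw [Finset.univ_unique, Finset.sort_singleton]
      rfl
    rw [inputs, code, h, List.foldr_cons, ← ih]
    rfl

theorem computable_code_inputs (T : SType ℕ ℕ) : Computable fun w => code (inputs w T) := by
  refine Primrec.to_comp ?_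
  simp only [code_inputs]
  refine Primrec.list_foldr (h := fun _ p => Nat.pair 1 (Encodable.encode [(p.1, p.2)]))
    Primrec.id (Primrec.const _) ?_
  refine Primrec₂.natPair.comp (Primrec.const 1) (Primrec.encode.comp ?_)
  exact Primrec.list_cons.comp (Primrec.pair (Primrec.fst.comp Primrec.snd)
    (Primrec.snd.comp Primrec.snd)) (Primrec.const [])

end SType

/-! ### Undecidability -/

/-- There is a program that solves an undecidable problem in the sense of halting. -/
theorem exists_code_not_computablePred :
    ∃ c : ToPartrec.Code, ¬ ComputablePred fun n : ℕ => (c.eval [n]).Dom := by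
  -- The program runs the code numbered `n` on input `0`; deciding its domain would decide halting.
  have hf : Partrec fun n : ℕ => Nat.Partrec.Code.eval (Denumerable.ofNat Nat.Partrec.Code n) 0 :=
    Nat.Partrec.Code.eval_part.comp (Computable.ofNat _) (Computable.const 0)
  obtain ⟨c, hc⟩ := ToPartrec.Code.exists_code (Nat.Partrec'.part_iff₁.2 hf)
  refine ⟨c, fun h => ComputablePred.halting_problem 0 ?_⟩
  have e : ∀ a : Nat.Partrec.Code,
      (c.eval [Encodable.encode a]).Dom ↔ (Nat.Partrec.Code.eval a 0).Dom := by
    intro a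
    have := hc ⟨[Encodable.encode a], rfl⟩
    simp only at this
    rw [this]
    simp [List.Vector.head]
  obtain ⟨g, hg, hgc⟩ := ComputablePred.computable_iff.1 h
  refine ComputablePred.computable_iff.2 ⟨fun a => g (Encodable.encode a),
    hg.comp Computable.encode, ?_⟩
  funext a
  rw [← e a]
  exact congrFun hgc _

open StackProgram in
/-- There is a single queue machine for which it is undecidable whether it loops. -/
theorem exists_machine_forall_loops_iff (c : ToPartrec.Code) :
    ∃ (M : QueueMachine ℕ ℕ) (x : ℕ → List ↥M.inputAlphabet),
      (∀ n, (¬ M.TerminatesOn (x n) ∧ M.BoundOn (x n)) ↔ (c.eval [n]).Dom) ∧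
      Computable fun n => (M.initQueue (x n)).map Subtype.val := by
  classical
  let S := codeSupp c Cont'.halt
  have hsupp := tr_supports c Cont'.halt
  have hS := tm2System_mem (M := tr) hsupp.2
  let p₀ : ↥(tm2States tr S) := ⟨((tr (trNormal c Cont'.halt), none), false),
    mem_tm2States.2 ⟨_, hsupp.1, TM2.stmts₁_self⟩⟩
  let u : ℕ → List (Sym K' Γ') := fun n => tag .main (trList [n])
  have hu : ∀ n, none ∉ u n := fun n => none_notMem_tag _ _
  refine ⟨(tm2System tr).toMachine _ hS p₀ none,
    fun n => (tm2System tr).toInput _ hS p₀ none (u n) (hu n), fun n => ?_, ?_⟩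
  · refine (QueueSystem.loopsFrom_iff _ _).symm.trans
      ((loopsFrom_tm2System_iff (trNormal c Cont'.halt) none (hu n)).trans ?_)
    have e : (⟨some (trNormal c Cont'.halt), none, fun k => proj k (u n)⟩ : Cfg') =
        init c [n] := by
      rw [init]
      congr 1
      funext k
      cases k <;> simp [u, proj_tag]
    have := tr_eval c [n]
    rw [← e] at this
    refine Iff.trans (iff_of_eq (congrArg Part.Dom this)) Iff.rfl
  -- The numbering of symbols is chosen non-constructively, but it is one fixed map on a finite
  -- alphabet and does not affect computability in `n`.
  · have e : ∀ n, (((tm2System tr).toMachine _ hS p₀ none).initQueue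
        ((tm2System tr).toInput _ hS p₀ none (u n) (hu n))).map Subtype.val =
        (trNat n).map (fun a => ((QueueSystem.symbolEquiv (Sym K' Γ'))
          (some (some (.main, a)))).1) ++
          [((QueueSystem.symbolEquiv (Sym K' Γ')) (some (some (.main, Γ'.cons)))).1,
            ((QueueSystem.symbolEquiv (Sym K' Γ')) none).1] := by
      intro n
      rw [QueueSystem.initQueue_toInput]
      refine (List.map_map ..).trans ?_
      simp only [u, tag, trList, List.map_append, List.map_cons, List.map_nil, List.map_map,
        List.append_assoc, List.cons_append, List.nil_append]
      rfl
    simp only [e]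
    exact Computable.list_append.comp (computable_map_trNat _) (Computable.const _)

/-- Only the queue type depends on `n`; the code of the control type is a constant. -/
theorem SType.not_boundedSubtypingDecidable : ¬ BoundedSubtypingDecidable := by
  rintro ⟨F, hF, hdec⟩
  obtain ⟨c, hc⟩ := exists_code_not_computablePred
  obtain ⟨M, x, hx, hcomp⟩ := exists_machine_forall_loops_iff c
  refine hc (ComputablePred.computable_iff.2 ?_)
  have h : ∀ n, ∃ b ∈ F ((M.encodeControl ∅ M.start).code,
      (M.encodeQueue 0 (M.initQueue (x n))).code), (b = true ↔ (c.eval [n]).Dom) := by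
    intro n
    obtain ⟨b, hb, hb'⟩ := hdec _ _ (M.isSessionType_encodeControl M.start)
      (M.isSessionType_encodeQueue 0 (M.initQueue (x n)))
    exact ⟨b, hb, by rw [hb', QueueMachine.boundedSubtype_iff, hx]⟩
  choose g hg hg' using h
  refine ⟨g, ?_, funext fun n => propext (hg' n).symm⟩
  have hcode : Computable fun n => (M.encodeQueue 0 (M.initQueue (x n))).code :=
    (computable_code_inputs _).comp hcomp
  -- `F` may diverge elsewhere, but both codes belong to session types, so its composition with the
  -- reduction is the total function `g`.
  exact (hF.comp ((Computable.const _).pair hcode)).of_eq fun n => Part.eq_some_iff.2 (hg n)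

theorem mainTheorem6 :
    (∀ (L : Type u) (V : Type v) [DecidableEq V] (M : QueueMachine L V)
      (x : List ↥M.inputAlphabet) (t : V),
      SType.BoundedSubtype (M.encodeControl ∅ M.start) (M.encodeQueue t (M.initQueue x)) ↔
        ¬ M.TerminatesOn x ∧ M.BoundOn x) ∧
    ¬ SType.BoundedSubtypingDecidable :=
  ⟨fun _ _ _ M x t => M.boundedSubtype_iff x t, SType.not_boundedSubtypingDecidable⟩
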